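/- Let $m\ge 1$ be an integer, let $d_1<\dots<d_m$ be non-negative integers, and let $\mathsf{A}=\{x^{d_1},\dots,x^{d_m}\}$ on $\mathcal{X}=(0,\infty)$. Put $s_{\mathsf A}(x)=(x^{d_1},\dots,x^{d_m})\in\mathbb{R}^m$ for $x\in\mathcal X$, and let \[ \mathcal{S}_{\mathsf A}=\Big\{\int_{\mathcal X} s_{\mathsf A}(x)\,\mathrm{d}\mu(x)\ :\ \mu \text{ a (positive) Borel measure on } \mathcal{X} \text{ for which } x^{d_1},\dots,x^{d_m} \text{ are integrable}\Big\}\subseteq\mathbb{R}^m \] be the moment cone. For $s\in\mathcal{S}_{\mathsf A}$ let the Carathéodory number $\mathcal{C}_{\mathsf A}(s)$ of $s$ be the least integer $k\ge 1$ such that $s=\sum_{j=1}^k c_j\, s_{\mathsf A}(x_j)$ for some $c_1,\dots,c_k\ge 0$ and $x_1,\dots,x_k\in(0,\infty)$, and let $\mathcal{C}_{\mathsf A}=\max_{s\in\mathcal{S}_{\mathsf A}}\mathcal{C}_{\mathsf A}(s)$. Then all these numbers are finite, the maximum is attained, and \[ \mathcal{C}_{\mathsf A}=\left\lceil\frac m2\right\rceil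 . \] -/

import Mathlib

namespace TruncatedMoment

noncomputable section

open MeasureTheory

/-- The moment map `s_A : X → ℝ^m`, `x ↦ (a_1(x), …, a_m(x))`. -/
def momentMap {X : Type*} {m : ℕ} (A : Fin m → X → ℝ) (x : X) : Fin m → ℝ :=
  fun i => A i x

/-- The moment map `S_{k,A} : ℝ_{≥0}^k × X^k → ℝ^m`, `(C, Y) ↦ ∑ j, c_j • s_A(y_j)`; its value is
the moment sequence of the atomic measure `∑ j, c_j • δ_{y_j}`. -/
def atomicMomentMap {X : Type*} {m : ℕ} (A : Fin m → X → ℝ) (k : ℕ)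
    (p : (Fin k → NNReal) × (Fin k → X)) : Fin m → ℝ :=
  ∑ j, (p.1 j : ℝ) • momentMap A (p.2 j)

/-- The moment cone `S_A`: the set of all moment sequences `(∫ a_1 dμ, …, ∫ a_m dμ)`, where `μ`
runs over all (positive, possibly infinite) measures on `X` for which every `a_i` is integrable. -/
def momentCone {X : Type*} [MeasurableSpace X] {m : ℕ} (A : Fin m → X → ℝ) :
    Set (Fin m → ℝ) :=
  {s | ∃ μ : Measure X, (∀ i, Integrable (A i) μ) ∧ ∀ i, s i = ∫ x, A i x ∂μ}

/-- The Carathéodory number `C_A(s)` of `s`: the least `k ≥ 1` with `s ∈ range S_{k,A}`.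
It is `⊤` if there is no such `k`. -/
def caratheodoryNumberAt {X : Type*} {m : ℕ} (A : Fin m → X → ℝ) (s : Fin m → ℝ) : ℕ∞ :=
  sInf {n : ℕ∞ | ∃ k : ℕ, 1 ≤ k ∧ s ∈ Set.range (atomicMomentMap A k) ∧ n = (k : ℕ∞)}

/-- The Carathéodory number `C_A`: the supremum of `C_A(s)` over `s` in the moment cone,
taken in `ℕ∞` (so it is `⊤` if the numbers `C_A(s)` are unbounded or one of them is infinite). -/
def caratheodoryNumber {X : Type*} [MeasurableSpace X] {m : ℕ} (A : Fin m → X → ℝ) : ℕ∞ :=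
  sSup (caratheodoryNumberAt A '' momentCone A)

/-- The system of monomials `x^{d_1}, …, x^{d_m}` on `(0, ∞)`. -/
def monomialSystem {m : ℕ} (d : Fin m → ℕ) : Fin m → Set.Ioi (0 : ℝ) → ℝ :=
  fun i x => (x : ℝ) ^ d i

end

end TruncatedMoment

namespace TruncatedMoment

open Polynomial Set MeasureTheory
open scoped NNReal

/-! Upper bound: a functional supporting the cone over the curve is a polynomial nonnegative on `(0,
∞)`; if its integral is `≤ 0`, the measure sits on its finitely many roots, so every moment sequence
is finitely atomic (`mem_span_of_mem_momentCone`). To reduce the atoms, divide by `x ^ d 0`, append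
one larger exponent, and over the given moments take the point of least last coordinate in the
convex hull of the lifted curve on some `[a, b]`. It is a boundary point, so its atoms are zeros of
a polynomial with `m + 1` monomials that is nonnegative on `[a, b]`. Zeros inside `(a, b)` are
double, and Descartes' rule allows at most `m` positive roots with multiplicity; handling the
endpoints gives `⌈m / 2⌉` zeros (`card_zeros_lacunary_le`). Lower bound: `m` monomials interpolate
at any `m` positive nodes, so a sum of `⌈m / 2⌉` distinct curve points cannot be written with fewer
atoms. -/

/-! ### Polynomials with few monomials and their positive zeros. -/

/-- The polynomial `∑ i, l i * X ^ e i` with prescribed exponents. -/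
noncomputable def lacunary {n : ℕ} (e : Fin n → ℕ) (l : Fin n → ℝ) : ℝ[X] :=
  ∑ i, C (l i) * X ^ e i

theorem eval_lacunary {n : ℕ} (e : Fin n → ℕ) (l : Fin n → ℝ) (x : ℝ) :
    (lacunary e l).eval x = ∑ i, l i * x ^ e i := by
  simp [lacunary, eval_finsetSum]

theorem coeff_lacunary {n : ℕ} (e : Fin n → ℕ) (l : Fin n → ℝ) (k : ℕ) :
    (lacunary e l).coeff k = ∑ i, if k = e i then l i else 0 := by
  simp [lacunary, coeff_C_mul, coeff_X_pow]

theorem coeff_lacunary_apply {n : ℕ} {e : Fin n → ℕ} (he : StrictMono e) (l : Fin n → ℝ)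
    (i : Fin n) : (lacunary e l).coeff (e i) = l i := by
  simp [coeff_lacunary, he.injective.eq_iff]

theorem lacunary_ne_zero {n : ℕ} {e : Fin n → ℕ} (he : StrictMono e) {l : Fin n → ℝ}
    (hl : l ≠ 0) : lacunary e l ≠ 0 := by
  obtain ⟨i, hi⟩ := Function.ne_iff.1 hl
  intro h
  apply hi
  rw [← coeff_lacunary_apply he l i, h]
  simp

theorem exists_of_mem_support_lacunary {n : ℕ} {e : Fin n → ℕ} {l : Fin n → ℝ} {k : ℕ}
    (hk : k ∈ (lacunary e l).support) : ∃ i, l i ≠ 0 ∧ e i = k := by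
  rw [mem_support_iff, coeff_lacunary] at hk
  obtain ⟨i, -, hi⟩ := Finset.exists_ne_zero_of_sum_ne_zero hk
  by_cases h : k = e i
  · exact ⟨i, by simpa [h] using hi, h.symm⟩
  · simp [h] at hi

theorem card_support_lacunary_le {n : ℕ} (e : Fin n → ℕ) (l : Fin n → ℝ) :
    (lacunary e l).support.card ≤ (Finset.univ.filter fun i => l i ≠ 0).card := by
  classical
  refine (Finset.card_le_card fun k hk => ?_).trans (Finset.card_image_le (f := e))
  obtain ⟨i, hi, rfl⟩ := exists_of_mem_support_lacunary hk
  exact Finset.mem_image_of_mem _ (by simpa using hi)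

/-- The number of sign variations is less than the number of nonzero coefficients. -/
theorem signVariations_add_one_le_card_support {p : ℝ[X]} (hp : p ≠ 0) :
    p.signVariations + 1 ≤ p.support.card := by
  induction h : p.support.card using Nat.strong_induction_on generalizing p with
  | _ k ih =>
    have hlt := eraseLead_support_card_lt hp
    by_cases h0 : p.eraseLead = 0
    · have : p.signVariations = 0 := by
        rw [← eraseLead_add_monomial_natDegree_leadingCoeff p, h0, zero_add,
          signVariations_monomial]
      have : 0 < p.support.card := Finset.card_pos.2 (nonempty_support_iff.2 hp)
      omega
    · have h1 := ih _ (h ▸ hlt) h0 rfl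
      have h2 := signVariations_le_eraseLead_succ (P := p)
      omega

/-- Descartes' bound: distinct positive points, counted with their multiplicities as roots of `p`,
are fewer than the nonzero coefficients of `p`. -/
theorem sum_count_roots_lt_card_support {p : ℝ[X]} (hp : p ≠ 0) {Z : Finset ℝ}
    (hZ : ∀ z ∈ Z, 0 < z) : ∑ z ∈ Z, p.roots.count z < p.support.card := by
  classical
  have h1 : ∑ z ∈ Z, p.roots.count z ≤ p.roots.countP (0 < ·) := by
    rw [Multiset.countP_eq_card_filter]
    set s := p.roots.filter (0 < ·) with hs
    rw [← Multiset.sum_count_eq_card (s := Z ∪ s.toFinset) (m := s) (by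
      intro a ha; simp [ha])]
    refine le_trans (Finset.sum_le_sum fun z hz => ?_)
      (Finset.sum_le_sum_of_subset Finset.subset_union_left)
    rw [hs, Multiset.count_filter_of_pos (hZ z hz)]
  have h2 := roots_countP_pos_le_signVariations (P := p)
  have h3 := signVariations_add_one_le_card_support hp
  omega

/-- The derivative vanishes too at a local minimum; this doubling is what halves the number of
atoms. -/
theorem two_le_count_roots_of_isLocalMin {p : ℝ[X]} (hp : p ≠ 0) {x : ℝ} (hx : p.eval x = 0)
    (hmin : IsLocalMin (fun y => p.eval y) x) : 2 ≤ p.roots.count x := by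
  rw [count_roots]
  exact (one_lt_rootMultiplicity_iff_isRoot hp).2
    ⟨hx, hmin.hasDerivAt_eq_zero (p.hasDerivAt x)⟩

theorem one_le_count_roots {p : ℝ[X]} (hp : p ≠ 0) {x : ℝ} (hx : p.eval x = 0) :
    1 ≤ p.roots.count x :=
  Multiset.one_le_count_iff_mem.2 ((mem_roots hp).2 hx)

/-- A polynomial that tends to infinity and has no roots beyond `b` is nonnegative there. -/
theorem eval_nonneg_of_forall_gt_ne_zero {p : ℝ[X]}
    (hlim : Filter.Tendsto (fun x => p.eval x) Filter.atTop Filter.atTop) {b : ℝ}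
    (hb : ∀ y, b < y → p.eval y ≠ 0) {y : ℝ} (hy : b < y) : 0 ≤ p.eval y := by
  by_contra! hneg
  obtain ⟨Y, hY, hyY⟩ := ((hlim.eventually_ge_atTop 0).and (Filter.eventually_ge_atTop y)).exists
  obtain ⟨z, hz, hz0⟩ := intermediate_value_Icc hyY p.continuous.continuousOn ⟨hneg.le, hY⟩
  exact hb z (hy.trans_le hz.1) hz0

theorem natDegree_lacunary {m : ℕ} {e : Fin (m + 1) → ℕ} (he : StrictMono e)
    {l : Fin (m + 1) → ℝ} (hl : l (Fin.last m) ≠ 0) :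
    (lacunary e l).natDegree = e (Fin.last m) := by
  refine natDegree_eq_of_le_of_coeff_ne_zero ?_ (by rwa [coeff_lacunary_apply he])
  rw [natDegree_le_iff_coeff_eq_zero]
  intro k hk
  by_contra h
  obtain ⟨i, -, rfl⟩ := exists_of_mem_support_lacunary (mem_support_iff.2 h)
  exact absurd (he.monotone (Fin.le_last i)) (by omega)

/-- A nonzero polynomial with `m + 1` prescribed exponents that is nonnegative on `[a, b]` and has
nonnegative coefficient at the largest exponent has at most `⌈m / 2⌉` zeros in `[a, b]`. -/
theorem card_zeros_lacunary_le {m : ℕ} (hm : 1 ≤ m) {e : Fin (m + 1) → ℕ} (he : StrictMono e)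
    {l : Fin (m + 1) → ℝ} (hl : l ≠ 0) (hlast : 0 ≤ l (Fin.last m)) {a b : ℝ} (ha : 0 < a)
    (hnn : ∀ x ∈ Icc a b, 0 ≤ (lacunary e l).eval x) {Z : Finset ℝ}
    (hZ : ∀ z ∈ Z, z ∈ Icc a b ∧ (lacunary e l).eval z = 0) : Z.card ≤ (m + 1) / 2 := by
  classical
  set p := lacunary e l with hp_def
  have hp : p ≠ 0 := lacunary_ne_zero he hl
  have hpos : ∀ z ∈ Z, 0 < z := fun z hz => ha.trans_le (hZ z hz).1.1
  have hint : ∀ z ∈ Z, z ≠ a → z ≠ b → 2 ≤ p.roots.count z := by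
    intro z hz hza hzb
    obtain ⟨⟨h1, h2⟩, h3⟩ := hZ z hz
    refine two_le_count_roots_of_isLocalMin hp h3 ?_
    filter_upwards [Icc_mem_nhds (lt_of_le_of_ne h1 hza.symm) (lt_of_le_of_ne h2 hzb)] with y hy
    rw [h3]
    exact hnn y hy
  have hind : ∀ c : ℝ, ∑ z ∈ Z, (if z = c then 1 else 0) ≤ 1 := by
    intro c
    rw [Finset.sum_ite_eq' Z c]
    split_ifs <;> simp
  -- Only `a` and `b` can be simple zeros, so the defect is at most 2. Each case below must gain one
  -- more.
  have hweak : 2 * Z.card ≤ ∑ z ∈ Z, p.roots.count z + 2 := by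
    have : 2 * Z.card ≤ ∑ z ∈ Z, (p.roots.count z + (if z = a then 1 else 0) +
        (if z = b then 1 else 0)) := by
      rw [mul_comm, ← smul_eq_mul, ← Finset.sum_const]
      refine Finset.sum_le_sum fun z hz => ?_
      have h1 := one_le_count_roots hp (hZ z hz).2
      have h2 := hint z hz
      split_ifs <;> grind
    rw [Finset.sum_add_distrib, Finset.sum_add_distrib] at this
    have h1 := hind a
    have h2 := hind b
    omega
  have hcard := card_support_lacunary_le e l
  have hdesc := sum_count_roots_lt_card_support hp hpos
  -- A vanishing last coefficient removes a monomial, so Descartes' bound drops by one.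
  rcases hlast.eq_or_lt with h0 | h0
  · have : (Finset.univ.filter fun i => l i ≠ 0).card < m + 1 := by
      conv_rhs => rw [← Fintype.card_fin (m + 1)]
      refine Finset.card_lt_univ_of_notMem (x := Fin.last m) ?_
      simp [← h0]
    rw [← hp_def] at hcard
    omega
  · have hm1 : (Finset.univ.filter fun i => l i ≠ 0).card ≤ m + 1 :=
      (Finset.card_le_univ _).trans (by simp)
    rw [← hp_def] at hcard
    have hdeg : p.natDegree = e (Fin.last m) := natDegree_lacunary he h0.ne'
    have hlim : Filter.Tendsto (fun x => p.eval x) Filter.atTop Filter.atTop := by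
      refine tendsto_atTop_of_leadingCoeff_nonneg p ?_ ?_
      · rw [← natDegree_pos_iff_degree_pos, hdeg]
        have : e 0 < e (Fin.last m) := he (Fin.lt_def.2 (by simpa using Nat.lt_of_lt_of_le one_pos hm))
        omega
      · rw [leadingCoeff, hdeg, hp_def, coeff_lacunary_apply he]
        exact h0.le
    by_cases hroot : ∃ y, b < y ∧ p.eval y = 0
    -- A root beyond `b` uses up one of the roots allowed by Descartes.
    · obtain ⟨y, hby, hy⟩ := hroot
      have hyZ : y ∉ Z := fun h => absurd (hZ y h).1.2 (not_le.2 hby)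
      by_cases hZe : Z.Nonempty
      · obtain ⟨z₀, hz₀⟩ := hZe
        have hy0 : 0 < y := (hpos z₀ hz₀).trans_le ((hZ z₀ hz₀).1.2.trans hby.le)
        have h1 := sum_count_roots_lt_card_support hp (Z := insert y Z) (by
          intro z hz
          rcases Finset.mem_insert.1 hz with rfl | hz
          · exact hy0
          · exact hpos z hz)
        rw [Finset.sum_insert hyZ] at h1
        have h2 := one_le_count_roots hp hy
        omega
      · simp [Finset.not_nonempty_iff_eq_empty.1 hZe]
    · push Not at hroot
      -- Without roots beyond `b`, nonnegativity extends to `[a, ∞)`; then a zero at `b` is double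
      -- unless `b = a`.
      have hnn' : ∀ y, a ≤ y → 0 ≤ p.eval y := fun y hy => by
        rcases le_or_gt y b with h | h
        · exact hnn y ⟨hy, h⟩
        · exact eval_nonneg_of_forall_gt_ne_zero hlim hroot h
      have : 2 * Z.card ≤ ∑ z ∈ Z, (p.roots.count z + (if z = a then 1 else 0)) := by
        rw [mul_comm, ← smul_eq_mul, ← Finset.sum_const]
        refine Finset.sum_le_sum fun z hz => ?_
        have h1 := one_le_count_roots hp (hZ z hz).2
        by_cases hza : z = a
        · simp only [hza, if_true] at h1 ⊢
          omega
        · have : 2 ≤ p.roots.count z := by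
            refine two_le_count_roots_of_isLocalMin hp (hZ z hz).2 ?_
            filter_upwards [Ioi_mem_nhds (lt_of_le_of_ne (hZ z hz).1.1 (Ne.symm hza))] with y hy
            rw [(hZ z hz).2]
            exact hnn' y (le_of_lt hy)
          omega
      rw [Finset.sum_add_distrib] at this
      have h1 := hind a
      omega

/-! ### Convex geometry: supporting functionals and compact hulls. -/

/-- A convex cone in `ℝⁿ` admits a nonzero supporting functional at every point that is not in its
interior. -/
theorem exists_supporting_functional {n : ℕ} (K : Submodule ℝ≥0 (Fin n → ℝ)) {x : Fin n → ℝ}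
    (hx : x ∉ interior (K : Set (Fin n → ℝ))) :
    ∃ l : Fin n → ℝ, l ≠ 0 ∧ (∀ y ∈ K, 0 ≤ ∑ i, l i * y i) ∧ ∑ i, l i * x i ≤ 0 := by
  have hsmul : ∀ (c : ℝ), 0 ≤ c → ∀ y ∈ K, c • y ∈ K := fun c hc y hy =>
    K.smul_mem (⟨c, hc⟩ : ℝ≥0) hy
  have hconv : Convex ℝ (K : Set (Fin n → ℝ)) := fun y hy z hz a b ha hb _ =>
    K.add_mem (hsmul a ha y hy) (hsmul b hb z hz)
  suffices h : ∃ f : (Fin n → ℝ) →ₗ[ℝ] ℝ, f ≠ 0 ∧ (∀ y ∈ K, 0 ≤ f y) ∧ f x ≤ 0 by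
    obtain ⟨f, hf, h1, h2⟩ := h
    have hfx : ∀ y, f y = ∑ i, f (Pi.single i 1) * y i := fun y => by
      conv_lhs => rw [pi_eq_sum_univ' y]
      simp [mul_comm, Pi.single]
    refine ⟨fun i => f (Pi.single i 1), fun h0 => hf ?_, fun y hy => ?_, ?_⟩
    · ext i
      simpa using congrFun h0 i
    · rw [← hfx]; exact h1 y hy
    · rw [← hfx]; exact h2
  by_cases hne : (interior (K : Set (Fin n → ℝ))).Nonempty
  · obtain ⟨f, hf, hle⟩ := geometric_hahn_banach_of_nonempty_interior_point hconv hx hne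
    have h0 : 0 ≤ f x := by simpa using hle 0 K.zero_mem
    refine ⟨-(f : (Fin n → ℝ) →ₗ[ℝ] ℝ), fun h => hf ?_, fun y hy => ?_, by simpa using h0⟩
    · ext1 y
      simpa using LinearMap.congr_fun h y
    · by_contra! hneg
      have hfy : 0 < f y := by simpa using hneg
      -- The factor scales `y` to a point of the cone where `f` equals `f x + 1`, above its bound.
      have := hle _ (hsmul ((f x + 1) / f y) (by positivity) y hy)
      rw [map_smul, smul_eq_mul, div_mul_cancel₀ _ hfy.ne'] at this
      linarith
  -- With empty interior the cone spans a proper subspace; a functional vanishing there works up to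
  -- sign.
  · have hspan : Submodule.span ℝ (K : Set (Fin n → ℝ)) < ⊤ := by
      rw [lt_top_iff_ne_top]
      intro h
      apply hne
      rw [hconv.interior_nonempty_iff_affineSpan_eq_top,
        ← insert_eq_of_mem (show (0 : Fin n → ℝ) ∈ (K : Set (Fin n → ℝ)) from K.zero_mem)]
      apply SetLike.coe_injective
      rw [affineSpan_insert_zero, h]
      rfl
    obtain ⟨f, hf, hker⟩ := Submodule.exists_le_ker_of_lt_top _ hspan
    have hz : ∀ y ∈ K, f y = 0 := fun y hy => hker (Submodule.subset_span hy)
    rcases le_total (f x) 0 with h | h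
    · exact ⟨f, hf, fun y hy => (hz y hy).ge, h⟩
    · exact ⟨-f, neg_ne_zero.2 hf, fun y hy => by simp [hz y hy], by simpa using h⟩

/-- The convex hull of a compact set in a finite-dimensional space is compact. -/
theorem isCompact_convexHull_of_finiteDimensional {E : Type*} [NormedAddCommGroup E]
    [NormedSpace ℝ E] [FiniteDimensional ℝ E] {s : Set E} (hs : IsCompact s) :
    IsCompact (convexHull ℝ s) := by
  classical
  rcases s.eq_empty_or_nonempty with rfl | ⟨x₀, hx₀⟩
  · simp
  -- Carathéodory's bound; unused slots get weight 0 and the point `x₀`.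
  set N := Module.finrank ℝ E + 1
  have himage : convexHull ℝ s = (fun q : (Fin N → ℝ) × (Fin N → E) => ∑ i, q.1 i • q.2 i) ''
      (stdSimplex ℝ (Fin N) ×ˢ univ.pi fun _ => s) := by
    apply Subset.antisymm
    · intro x hx
      obtain ⟨ι, _, z, w, hz, hind, hw, hw1, rfl⟩ := eq_pos_convex_span_of_mem_convexHull hx
      have hcard : Fintype.card ι ≤ Fintype.card (Fin N) := by
        rw [Fintype.card_fin]
        exact hind.card_le_finrank_succ.trans
          (Nat.add_le_add_right (Submodule.finrank_le _) 1)
      obtain ⟨g⟩ := Function.Embedding.nonempty_of_card_le hcard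
      have hw' : ∀ i, i ∉ range g → Function.extend g w 0 i = 0 := fun i hi => by
        rw [Function.extend_apply' _ _ _ hi]; rfl
      refine ⟨(Function.extend g w 0, Function.extend g z fun _ => x₀),
        ⟨⟨fun i => ?_, ?_⟩, fun i _ => ?_⟩, ?_⟩
      · dsimp only
        by_cases hi : i ∈ range g
        · obtain ⟨j, rfl⟩ := hi
          rw [g.injective.extend_apply]
          exact (hw j).le
        · rw [hw' i hi]
      · rw [← hw1]
        exact (Fintype.sum_of_injective g g.injective _ _ hw' fun j =>
          (g.injective.extend_apply _ _ j).symm).symm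
      · by_cases hi : i ∈ range g
        · obtain ⟨j, rfl⟩ := hi
          simp only [g.injective.extend_apply]
          exact hz ⟨j, rfl⟩
        · simp only [Function.extend_apply' _ _ _ hi]
          exact hx₀
      · exact (Fintype.sum_of_injective g g.injective _ _ (fun i hi => by simp [hw' i hi])
          fun j => by simp [g.injective.extend_apply]).symm
    · rintro _ ⟨⟨w, z⟩, ⟨⟨hw0, hw1⟩, hz⟩, rfl⟩
      exact (convex_convexHull ℝ s).sum_mem (fun i _ => hw0 i) hw1
        fun i _ => subset_convexHull ℝ s (hz i (mem_univ i))
  rw [himage]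
  exact ((isCompact_stdSimplex ℝ (Fin N)).prod (isCompact_univ_pi fun _ => hs)).image
    (by fun_prop)

/-! ### Index reduction for atomic measures. -/

/-- The curve `x ↦ (x ^ e 0, …, x ^ e (n - 1))`. -/
def monomialCurve {n : ℕ} (e : Fin n → ℕ) (x : ℝ) : Fin n → ℝ := fun i => x ^ e i

theorem continuous_monomialCurve {n : ℕ} (e : Fin n → ℕ) : Continuous (monomialCurve e) :=
  continuous_pi fun i => continuous_pow (e i)

theorem sum_mul_monomialCurve {n : ℕ} (e : Fin n → ℕ) (l : Fin n → ℝ) (x : ℝ) :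
    ∑ i, l i * monomialCurve e x i = (lacunary e l).eval x :=
  (eval_lacunary e l x).symm

theorem sum_mul_sum_smul {n : ℕ} {ι : Type*} [Fintype ι] (e : Fin n → ℕ) (l : Fin n → ℝ)
    (w x : ι → ℝ) : ∑ i, l i * (∑ j, w j • monomialCurve e (x j)) i =
      ∑ j, w j * (lacunary e l).eval (x j) := by
  simp_rw [← sum_mul_monomialCurve, Finset.sum_apply, Finset.mul_sum]
  rw [Finset.sum_comm]
  refine Finset.sum_congr rfl fun j _ => Finset.sum_congr rfl fun i _ => ?_
  simp only [Pi.smul_apply, smul_eq_mul]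
  ring

/-- A point of the cone over a curve with first coordinate `1` that itself has first coordinate `1`
lies in the convex hull of the curve. -/
theorem mem_convexHull_of_mem_span {m : ℕ} {e : Fin (m + 1) → ℕ} (h0 : e 0 = 0) {S : Set ℝ}
    {y : Fin (m + 1) → ℝ} (hy : y ∈ Submodule.span ℝ≥0 (monomialCurve e '' S)) (hy0 : y 0 = 1) :
    y ∈ convexHull ℝ (monomialCurve e '' S) := by
  rw [image_eq_range] at hy ⊢
  obtain ⟨c, rfl⟩ := Finsupp.mem_span_range_iff_exists_finsupp.1 hy
  rw [Finsupp.sum, Finset.sum_apply] at hy0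
  rw [Finsupp.sum]
  refine (convex_convexHull ℝ _).sum_mem (w := fun x => (c x : ℝ)) (fun x _ => (c x).2) ?_
    fun x _ => subset_convexHull ℝ _ ⟨x, rfl⟩
  simpa [monomialCurve, h0, NNReal.smul_def] using hy0

/-- Among the points of a compact convex set, over a given base point, there is one of least last
coordinate. -/
theorem exists_min_last {m : ℕ} {Q : Set (Fin (m + 1) → ℝ)} (hQ : IsCompact Q)
    {u₀ : Fin (m + 1) → ℝ} (hu₀ : u₀ ∈ Q) :
    ∃ u ∈ Q, (∀ i : Fin m, u i.castSucc = u₀ i.castSucc) ∧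
      ∀ y ∈ Q, (∀ i : Fin m, y i.castSucc = u₀ i.castSucc) → u (Fin.last m) ≤ y (Fin.last m) := by
  have hcl : IsClosed {y : Fin (m + 1) → ℝ | ∀ i : Fin m, y i.castSucc = u₀ i.castSucc} := by
    simp only [ofPred_forall]
    exact isClosed_iInter fun i => isClosed_eq (continuous_apply _) continuous_const
  obtain ⟨u, ⟨hu, hu'⟩, hmin⟩ := (hQ.inter_right hcl).exists_isMinOn ⟨u₀, hu₀, fun _ => rfl⟩
    (continuous_apply (Fin.last m)).continuousOn
  exact ⟨u, hu, hu', fun y hy hy' => hmin ⟨hy, hy'⟩⟩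

/-- Index reduction for normalised atomic measures: the first `m` of `m + 1` moments of a finitely
atomic probability measure are moments of a measure with at most `⌈m / 2⌉` atoms. -/
theorem exists_few_atoms_of_normalized {m : ℕ} (hm : 1 ≤ m) {e : Fin (m + 1) → ℕ}
    (he : StrictMono e) (h0 : e 0 = 0) {ι : Type*} [Fintype ι] {w x : ι → ℝ}
    (hw : ∀ j, 0 ≤ w j) (hw1 : ∑ j, w j = 1) (hx : ∀ j, 0 < x j) :
    ∃ Z : Finset ℝ, (∀ z ∈ Z, 0 < z) ∧ Z.card ≤ (m + 1) / 2 ∧ ∃ v : ℝ → ℝ, (∀ z, 0 ≤ v z) ∧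
      ∀ i : Fin m, ∑ z ∈ Z, v z * z ^ e i.castSucc = ∑ j, w j * x j ^ e i.castSucc := by
  classical
  obtain ⟨a, b, ha, hab⟩ : ∃ a b : ℝ, 0 < a ∧ ∀ j, x j ∈ Icc a b := by
    have : Nonempty ι := by
      by_contra h
      rw [not_nonempty_iff] at h
      simp at hw1
    obtain ⟨j₁, h₁⟩ := Finite.exists_min x
    obtain ⟨j₂, h₂⟩ := Finite.exists_max x
    exact ⟨x j₁, x j₂, hx j₁, fun j => ⟨h₁ j, h₂ j⟩⟩
  set Q := convexHull ℝ (monomialCurve e '' Icc a b) with hQ_def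
  have hQ : IsCompact Q := isCompact_convexHull_of_finiteDimensional
    (isCompact_Icc.image (continuous_monomialCurve e))
  have hu₀ : ∑ j, w j • monomialCurve e (x j) ∈ Q :=
    (convex_convexHull ℝ _).sum_mem (fun j _ => hw j) hw1
      fun j _ => subset_convexHull ℝ _ ⟨x j, hab j, rfl⟩
  obtain ⟨u, huQ, hu, hmin⟩ := exists_min_last hQ hu₀
  have hzero : ∀ y : Fin (m + 1) → ℝ, (∀ i : Fin m, y i.castSucc =
      (∑ j, w j • monomialCurve e (x j)) i.castSucc) → y 0 = 1 := by
    intro y hy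
    have := hy ⟨0, hm⟩
    have h' : (⟨0, hm⟩ : Fin m).castSucc = 0 := rfl
    rw [h', Finset.sum_apply] at this
    simpa [monomialCurve, h0, hw1] using this
  -- The added upward ray makes the last coefficient of a supporting functional nonnegative.
  let K : Submodule ℝ≥0 (Fin (m + 1) → ℝ) :=
    Submodule.span ℝ≥0 (monomialCurve e '' Icc a b) ⊔
      Submodule.span ℝ≥0 {Pi.single (Fin.last m) 1}
  have hne : ∀ i : Fin m, i.castSucc ≠ Fin.last m := fun i => (Fin.castSucc_lt_last i).ne
  have hint : u ∉ interior (K : Set (Fin (m + 1) → ℝ)) := by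
    intro hmem
    have hcont : Continuous fun t : ℝ => u - t • (Pi.single (Fin.last m) 1 : Fin (m + 1) → ℝ) := by
      fun_prop
    have hnhds : ∀ᶠ t : ℝ in nhds 0,
        u - t • (Pi.single (Fin.last m) 1 : Fin (m + 1) → ℝ) ∈ (K : Set (Fin (m + 1) → ℝ)) := by
      refine hcont.continuousAt.eventually_mem ?_
      simpa using mem_interior_iff_mem_nhds.1 hmem
    -- An interior `u` could be lowered by some `t > 0` within `K`; dropping the ray part lowers it
    -- further, against minimality.
    obtain ⟨t, htK, ht⟩ :=
      ((hnhds.filter_mono nhdsWithin_le_nhds).and (self_mem_nhdsWithin (s := Ioi (0 : ℝ)))).exists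
    obtain ⟨y, hy, z, hz, hyz⟩ := Submodule.mem_sup.1 htK
    obtain ⟨r, rfl⟩ := Submodule.mem_span_singleton.1 hz
    have hyu : ∀ i : Fin m, y i.castSucc = (∑ j, w j • monomialCurve e (x j)) i.castSucc := by
      intro i
      rw [← hu i]
      have := congrFun hyz i.castSucc
      simpa [hne i] using this
    have hle := hmin y (mem_convexHull_of_mem_span h0 hy (hzero y hyu)) hyu
    have hlast := congrFun hyz (Fin.last m)
    simp only [Pi.add_apply, Pi.sub_apply, Pi.smul_apply, Pi.single_eq_same, NNReal.smul_def,
      smul_eq_mul, mul_one] at hlast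
    have := r.2
    have ht' : 0 < t := ht
    linarith
  obtain ⟨l, hl, hK, hlu⟩ := exists_supporting_functional K hint
  have hnn : ∀ y ∈ Icc a b, 0 ≤ (lacunary e l).eval y := fun y hy => by
    rw [← sum_mul_monomialCurve]
    exact hK _ (Submodule.mem_sup_left (Submodule.subset_span ⟨y, hy, rfl⟩))
  have hlast : 0 ≤ l (Fin.last m) := by
    have := hK _ (Submodule.mem_sup_right (Submodule.mem_span_singleton_self _))
    simpa [Pi.single_apply] using this
  obtain ⟨κ, _, v, y, hv, -, hy, hyu⟩ := mem_convexHull_iff_exists_fintype.1 huQ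
  choose z hz hzy using hy
  have hp := lacunary_ne_zero he hl
  let Z := (lacunary e l).roots.toFinset.filter (· ∈ Icc a b)
  have hZ : ∀ t, t ∈ Z ↔ t ∈ Icc a b ∧ (lacunary e l).eval t = 0 := by
    intro t
    simp [Z, hp, and_comm]
  have hvz : ∀ k, v k ≠ 0 → z k ∈ Z := by
    have hsum : ∑ k, v k * (lacunary e l).eval (z k) = 0 := by
      refine le_antisymm ?_ (Finset.sum_nonneg fun k _ => mul_nonneg (hv k) (hnn _ (hz k)))
      rw [← sum_mul_sum_smul]
      simpa only [hzy, hyu] using hlu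
    intro k hk
    have := (Finset.sum_eq_zero_iff_of_nonneg
      fun k _ => mul_nonneg (hv k) (hnn _ (hz k))).1 hsum k (Finset.mem_univ k)
    exact (hZ _).2 ⟨hz k, (mul_eq_zero.1 this).resolve_left hk⟩
  refine ⟨Z, fun t ht => ha.trans_le ((hZ t).1 ht).1.1,
    card_zeros_lacunary_le hm he hl hlast ha hnn fun t ht => (hZ t).1 ht,
    -- Atoms at the same point are merged.
    fun t => ∑ k with z k = t, v k, fun t => Finset.sum_nonneg fun k _ => hv k, fun i => ?_⟩
  have hui := hu i
  rw [← hyu, Finset.sum_apply, Finset.sum_apply] at hui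
  simp only [← hzy, Pi.smul_apply, smul_eq_mul, monomialCurve] at hui
  rw [← hui]
  have hfib : ∀ t, (∑ k with z k = t, v k) * t ^ e i.castSucc =
      ∑ k with z k = t, v k * z k ^ e i.castSucc := fun t => by
    rw [Finset.sum_mul]
    refine Finset.sum_congr rfl fun k hk => ?_
    rw [(Finset.mem_filter.1 hk).2]
  simp_rw [hfib]
  rw [Finset.sum_fiberwise_eq_sum_filter]
  refine Finset.sum_filter_of_ne fun k _ hk => hvz k (left_ne_zero_of_mul hk)

/-- The moments of a finitely atomic measure on `(0, ∞)` are represented by at most `⌈m / 2⌉`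
atoms. -/
theorem exists_few_atoms {m : ℕ} (hm : 1 ≤ m) {d : Fin m → ℕ} (hd : StrictMono d)
    {ι : Type*} [Fintype ι] {c x : ι → ℝ} (hc : ∀ j, 0 ≤ c j) (hx : ∀ j, 0 < x j) :
    ∃ Z : Finset ℝ, (∀ z ∈ Z, 0 < z) ∧ Z.card ≤ (m + 1) / 2 ∧ ∃ v : ℝ → ℝ,
      (∀ z ∈ Z, 0 ≤ v z) ∧ ∀ i, ∑ z ∈ Z, v z * z ^ d i = ∑ j, c j * x j ^ d i := by
  set i₀ : Fin m := ⟨0, hm⟩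
  have hmin : ∀ i, d i₀ ≤ d i := fun i => hd.monotone (Fin.le_def.2 (Nat.zero_le _))
  set S := ∑ j, c j * x j ^ d i₀ with hS
  have hterm : ∀ j, 0 ≤ c j * x j ^ d i₀ := fun j => mul_nonneg (hc j) (pow_nonneg (hx j).le _)
  rcases (Finset.sum_nonneg fun j _ => hterm j : 0 ≤ S).eq_or_lt with h | hSpos
  · refine ⟨∅, by simp, by simp, 0, by simp, fun i => ?_⟩
    rw [Finset.sum_empty, eq_comm]
    refine Finset.sum_eq_zero fun j _ => ?_
    have := (Finset.sum_eq_zero_iff_of_nonneg fun j _ => hterm j).1 h.symm j (Finset.mem_univ j)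
    rw [(mul_eq_zero.1 this).resolve_right (pow_ne_zero _ (hx j).ne'), zero_mul]
  · rw [← hS] at hSpos
    have hS0 := hSpos.ne'
    -- Shifting by `d i₀` makes the first exponent 0; the appended one only has to exceed the
    -- others.
    let e : Fin (m + 1) → ℕ :=
      Fin.snoc (fun i => d i - d i₀) (d ⟨m - 1, by omega⟩ + 1)
    have hec : ∀ i : Fin m, e i.castSucc = d i - d i₀ := fun i => by simp [e]
    have he : StrictMono e := by
      intro i j
      induction i using Fin.lastCases with
      | last => exact fun h => absurd h (Fin.le_last j).not_gt
      | cast i =>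
        induction j using Fin.lastCases with
        | last =>
          intro _
          have : d i ≤ d ⟨m - 1, by omega⟩ := hd.monotone (Fin.le_def.2 (by simp; omega))
          rw [hec]
          simp only [e, Fin.snoc_last]
          omega
        | cast j =>
          intro h
          have := hd (Fin.castSucc_lt_castSucc_iff.1 h)
          have := hmin i
          rw [hec, hec]
          omega
    have he0 : e 0 = 0 := by
      rw [show (0 : Fin (m + 1)) = i₀.castSucc from rfl, hec, Nat.sub_self]
    obtain ⟨Z, hZ, hcard, v, hv, hmom⟩ := exists_few_atoms_of_normalized hm he he0
      (w := fun j => c j * x j ^ d i₀ / S) (fun j => div_nonneg (hterm j) hSpos.le)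
      (by rw [← Finset.sum_div, ← hS, div_self hSpos.ne']) hx
    refine ⟨Z, hZ, hcard, fun z => S * v z / z ^ d i₀,
      fun z hz => div_nonneg (mul_nonneg hSpos.le (hv z)) (pow_nonneg (hZ z hz).le _),
      fun i => ?_⟩
    have hpow : ∀ t : ℝ, t ^ d i = t ^ d i₀ * t ^ (d i - d i₀) := fun t => by
      rw [← pow_add, Nat.add_sub_cancel' (hmin i)]
    have h1 := hmom i
    rw [hec] at h1
    calc ∑ z ∈ Z, S * v z / z ^ d i₀ * z ^ d i
        = S * ∑ z ∈ Z, v z * z ^ (d i - d i₀) := by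
          rw [Finset.mul_sum]
          refine Finset.sum_congr rfl fun z hz => ?_
          have := pow_ne_zero (d i₀) (hZ z hz).ne'
          rw [hpow]
          field_simp
      _ = ∑ j, c j * x j ^ d i := by
          rw [h1, Finset.mul_sum]
          refine Finset.sum_congr rfl fun j _ => ?_
          rw [hpow]
          field_simp

/-! ### From measures to few atoms. -/

/-- Every moment sequence of the monomial system is represented by finitely many atoms. -/
theorem mem_span_of_mem_momentCone {m : ℕ} {d : Fin m → ℕ} (hd : StrictMono d)
    {s : Fin m → ℝ} (hs : s ∈ momentCone (monomialSystem d)) :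
    s ∈ Submodule.span ℝ≥0 (range (momentMap (monomialSystem d))) := by
  classical
  by_contra hmem
  obtain ⟨μ, hint, hμ⟩ := hs
  obtain ⟨l, hl, hK, hls⟩ := exists_supporting_functional _
    fun h => hmem (interior_subset h)
  have hp := lacunary_ne_zero hd hl
  have heval : ∀ x : Ioi (0 : ℝ), ∑ i, l i * monomialSystem d i x = (lacunary d l).eval (x : ℝ) :=
    fun x => (eval_lacunary d l x).symm
  have hnn : ∀ x : Ioi (0 : ℝ), 0 ≤ (lacunary d l).eval (x : ℝ) := fun x => by
    rw [← heval]
    exact hK _ (Submodule.subset_span ⟨x, rfl⟩)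
  have hpint : Integrable (fun x : Ioi (0 : ℝ) => (lacunary d l).eval (x : ℝ)) μ := by
    simp_rw [← heval]
    exact integrable_finsetSum _ fun i _ => (hint i).const_mul _
  have hzero : ∫ x : Ioi (0 : ℝ), (lacunary d l).eval (x : ℝ) ∂μ = 0 := by
    refine le_antisymm ?_ (integral_nonneg hnn)
    simp_rw [← heval]
    rw [integral_finsetSum _ fun i _ => (hint i).const_mul _]
    simpa [integral_const_mul, ← hμ] using hls
  -- A nonnegative polynomial with zero integral vanishes a.e., so `μ` is concentrated on its roots.
  have hae := (integral_eq_zero_iff_of_nonneg hnn hpint).1 hzero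
  let Z : Finset (Ioi (0 : ℝ)) :=
    ((lacunary d l).roots.toFinset.finite_toSet.preimage Subtype.val_injective.injOn).toFinset
  have hZ : ∀ᵐ x ∂μ, x ∈ (Z : Set (Ioi (0 : ℝ))) := by
    filter_upwards [hae] with x hx
    simpa [Z, hp] using hx
  apply hmem
  have hsum : s = ∑ z ∈ Z, (⟨μ.real {z}, measureReal_nonneg⟩ : ℝ≥0) •
      momentMap (monomialSystem d) z := by
    ext i
    rw [hμ i, ← Measure.restrict_eq_self_of_ae_mem hZ,
      setIntegral_finset _ (hint i).integrableOn, Measure.restrict_eq_self_of_ae_mem hZ,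
      Finset.sum_apply]
    rfl
  rw [hsum]
  exact Submodule.sum_mem _ fun z _ => Submodule.smul_mem _ _ (Submodule.subset_span ⟨z, rfl⟩)

theorem natCeil_half (m : ℕ) : ⌈(m : ℝ) / 2⌉₊ = (m + 1) / 2 := by
  apply le_antisymm
  · have : m ≤ 2 * ((m + 1) / 2) := by omega
    have : (m : ℝ) ≤ 2 * ((m + 1) / 2 : ℕ) := by exact_mod_cast this
    exact Nat.ceil_le.2 (by linarith)
  · have h : (m : ℝ) ≤ 2 * (⌈(m : ℝ) / 2⌉₊ : ℕ) := by
      linarith [Nat.le_ceil ((m : ℝ) / 2)]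
    have : m ≤ 2 * ⌈(m : ℝ) / 2⌉₊ := by exact_mod_cast h
    omega

theorem atomicMomentMap_monomialSystem_apply {m : ℕ} (d : Fin m → ℕ) (k : ℕ)
    (p : (Fin k → ℝ≥0) × (Fin k → Ioi (0 : ℝ))) (i : Fin m) :
    atomicMomentMap (monomialSystem d) k p i = ∑ j, (p.1 j : ℝ) * (p.2 j : ℝ) ^ d i := by
  simp [atomicMomentMap, momentMap, monomialSystem]

/-- A measure with atoms in a set of at most `k` points has moments in the range of the `k`-atomic
moment map. -/
theorem mem_range_atomicMomentMap {m : ℕ} {d : Fin m → ℕ} {k : ℕ} {s : Fin m → ℝ} {Z : Finset ℝ}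
    (hZ : ∀ z ∈ Z, 0 < z) (hcard : Z.card ≤ k) {v : ℝ → ℝ} (hv : ∀ z ∈ Z, 0 ≤ v z)
    (hs : ∀ i, s i = ∑ z ∈ Z, v z * z ^ d i) :
    s ∈ range (atomicMomentMap (monomialSystem d) k) := by
  classical
  obtain ⟨g⟩ : Nonempty (Z ↪ Fin k) :=
    Function.Embedding.nonempty_of_card_le (by simpa using hcard)
  refine ⟨(Function.extend g (fun z : Z => (v z).toNNReal) 0,
    Function.extend g (fun z : Z => (⟨z, hZ z z.2⟩ : Ioi (0 : ℝ))) fun _ => ⟨1, mem_Ioi.2 one_pos⟩), ?_⟩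
  ext i
  rw [atomicMomentMap_monomialSystem_apply, hs i, ← Finset.sum_coe_sort Z]
  refine (Fintype.sum_of_injective g g.injective _ _ (fun j hj => ?_) fun z => ?_).symm
  · simp [Function.extend_apply' _ _ _ hj]
  · simp [g.injective.extend_apply, hv z z.2]

/-- Every point of the moment cone is represented by `⌈m / 2⌉` atoms. -/
theorem mem_range_atomicMomentMap_of_mem_momentCone {m : ℕ} (hm : 1 ≤ m) {d : Fin m → ℕ}
    (hd : StrictMono d) {s : Fin m → ℝ} (hs : s ∈ momentCone (monomialSystem d)) :
    s ∈ range (atomicMomentMap (monomialSystem d) ((m + 1) / 2)) := by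
  obtain ⟨c, hc⟩ :=
    Finsupp.mem_span_range_iff_exists_finsupp.1 (mem_span_of_mem_momentCone hd hs)
  obtain ⟨Z, hZ, hcard, v, hv, hmom⟩ := exists_few_atoms hm hd (ι := c.support)
    (c := fun x => (c x : ℝ)) (x := fun x => ((x : Ioi (0 : ℝ)) : ℝ))
    (fun x => (c x).2) fun x => x.1.2
  refine mem_range_atomicMomentMap hZ hcard hv fun i => ?_
  rw [hmom i, ← hc, Finsupp.sum, Finset.sum_apply,
    Finset.sum_coe_sort c.support fun x => (c x : ℝ) * (x : ℝ) ^ d i]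
  rfl

/-! ### The lower bound. -/

/-- Interpolation at `m` positive nodes: some combination of `m` monomials is `1` at a given node
and `0` at the others. -/
theorem exists_lacunary_eval_eq_ite {m : ℕ} {d : Fin m → ℕ} (hd : StrictMono d)
    {W : Finset (Ioi (0 : ℝ))} (hW : W.card = m) (x₀ : Ioi (0 : ℝ)) :
    ∃ l : Fin m → ℝ, ∀ x ∈ W,
      (lacunary d l).eval (x : ℝ) = if (x : ℝ) = x₀ then 1 else 0 := by
  let f : (Fin m → ℝ) →ₗ[ℝ] (W → ℝ) :=
    { toFun := fun l x => (lacunary d l).eval ((x : Ioi (0 : ℝ)) : ℝ)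
      map_add' := fun l l' => by
        ext x
        simp [eval_lacunary, add_mul, Finset.sum_add_distrib]
      map_smul' := fun c l => by
        ext x
        simp [eval_lacunary, Finset.mul_sum, mul_assoc] }
  have hinj : Function.Injective f := by
    rw [injective_iff_map_eq_zero]
    intro l hl
    by_contra hne
    have hp := lacunary_ne_zero hd hne
    have h1 := sum_count_roots_lt_card_support hp
      (Z := W.map (Function.Embedding.subtype _)) (by
        intro z hz
        obtain ⟨x, -, rfl⟩ := Finset.mem_map.1 hz
        exact x.2)
    have h2 : W.card ≤ ∑ z ∈ W.map (Function.Embedding.subtype _),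
        (lacunary d l).roots.count z := by
      rw [Finset.sum_map, Finset.card_eq_sum_ones]
      exact Finset.sum_le_sum fun x hx => one_le_count_roots hp (congrFun hl ⟨x, hx⟩)
    have h3 := (card_support_lacunary_le d l).trans (Finset.card_le_univ _)
    rw [Fintype.card_fin] at h3
    omega
  have hsurj : Function.Surjective f :=
    (LinearMap.injective_iff_surjective_of_finrank_eq_finrank (by simp [hW])).1 hinj
  obtain ⟨l, hl⟩ := hsurj fun x => if ((x : Ioi (0 : ℝ)) : ℝ) = x₀ then 1 else 0
  exact ⟨l, fun x hx => congrFun hl ⟨x, hx⟩⟩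

/-- The sum of the curve over a set of points lies in the moment cone. -/
theorem sum_momentMap_mem_momentCone {m : ℕ} (d : Fin m → ℕ) (X : Finset (Ioi (0 : ℝ))) :
    ∑ x ∈ X, momentMap (monomialSystem d) x ∈ momentCone (monomialSystem d) := by
  have hint : ∀ i, ∀ x ∈ X, Integrable (monomialSystem d i) (Measure.dirac x) :=
    fun i x _ => integrable_dirac (by simp)
  refine ⟨∑ x ∈ X, Measure.dirac x, fun i => integrable_finsetSum_measure.2 (hint i), fun i => ?_⟩
  rw [integral_finsetSum_measure (hint i), Finset.sum_apply]
  simp [momentMap]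

/-- The sum of the curve over a set of points is not represented by fewer atoms, as long as the
total number of points and atoms is at most `m`. -/
theorem card_le_of_sum_momentMap_mem_range {m : ℕ} {d : Fin m → ℕ} (hd : StrictMono d)
    {X : Finset (Ioi (0 : ℝ))} (hX : 2 * X.card ≤ m + 1) {k : ℕ}
    (hs : ∑ x ∈ X, momentMap (monomialSystem d) x ∈
      range (atomicMomentMap (monomialSystem d) k)) : X.card ≤ k := by
  classical
  by_contra! hk
  obtain ⟨⟨c, y⟩, hcy⟩ := hs
  have hYcard : (Finset.univ.image y).card ≤ k := Finset.card_image_le.trans (by simp)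
  obtain ⟨x₀, hx₀, hx₀y⟩ := Finset.exists_mem_notMem_of_card_lt_card (hYcard.trans_lt hk)
  -- From `k < X.card` and `2 * X.card ≤ m + 1`, points and atoms number at most `m`; pad to exactly
  -- `m` nodes.
  obtain ⟨W, hXW, hW⟩ := Infinite.exists_superset_card_eq (X ∪ Finset.univ.image y) m
    ((Finset.card_union_le _ _).trans (by omega))
  obtain ⟨l, hl⟩ := exists_lacunary_eval_eq_ite hd hW x₀
  have h1 : ∑ i, l i * (∑ x ∈ X, momentMap (monomialSystem d) x) i = 1 := by
    have : ∑ i, l i * (∑ x ∈ X, momentMap (monomialSystem d) x) i =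
        ∑ x ∈ X, (lacunary d l).eval (x : ℝ) := by
      simp_rw [eval_lacunary, Finset.sum_apply, Finset.mul_sum]
      rw [Finset.sum_comm]
      rfl
    rw [this, Finset.sum_eq_single_of_mem x₀ hx₀]
    · rw [hl x₀ (hXW (Finset.mem_union_left _ hx₀)), if_pos rfl]
    · intro x hx hne
      rw [hl x (hXW (Finset.mem_union_left _ hx)), if_neg fun h => hne (Subtype.ext h)]
  have h2 : ∑ i, l i * atomicMomentMap (monomialSystem d) k (c, y) i = 0 := by
    have : ∑ i, l i * atomicMomentMap (monomialSystem d) k (c, y) i =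
        ∑ j, (c j : ℝ) * (lacunary d l).eval (y j : ℝ) :=
      sum_mul_sum_smul d l (fun j => (c j : ℝ)) fun j => (y j : ℝ)
    rw [this]
    refine Finset.sum_eq_zero fun j _ => ?_
    have hj : y j ∈ Finset.univ.image y := Finset.mem_image_of_mem y (Finset.mem_univ j)
    rw [hl _ (hXW (Finset.mem_union_right _ hj)), if_neg, mul_zero]
    exact fun h => hx₀y (Subtype.ext h ▸ hj)
  rw [hcy, h1] at h2
  exact one_ne_zero h2

end TruncatedMoment

open TruncatedMoment in
theorem mainTheorem4 (m : ℕ) (hm : 1 ≤ m) (d : Fin m → ℕ) (hd : StrictMono d) :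
    TruncatedMoment.caratheodoryNumber (TruncatedMoment.monomialSystem d) =
        ((⌈(m : ℝ) / 2⌉₊ : ℕ) : ℕ∞) ∧
      ∃ s ∈ TruncatedMoment.momentCone (TruncatedMoment.monomialSystem d),
        TruncatedMoment.caratheodoryNumberAt (TruncatedMoment.monomialSystem d) s =
          TruncatedMoment.caratheodoryNumber (TruncatedMoment.monomialSystem d) := by
  have hle : ∀ s ∈ momentCone (monomialSystem d),
      caratheodoryNumberAt (monomialSystem d) s ≤ ((m + 1) / 2 : ℕ) := fun s hs =>
    sInf_le ⟨_, by omega, mem_range_atomicMomentMap_of_mem_momentCone hm hd hs, rfl⟩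
  obtain ⟨X, hX⟩ := Infinite.exists_subset_card_eq (Set.Ioi (0 : ℝ)) ((m + 1) / 2)
  have hmem := sum_momentMap_mem_momentCone d X
  have hge : ((m + 1) / 2 : ℕ) ≤ caratheodoryNumberAt (monomialSystem d)
      (∑ x ∈ X, momentMap (monomialSystem d) x) := by
    refine le_sInf ?_
    rintro _ ⟨k, -, hk, rfl⟩
    rw [← hX]
    exact_mod_cast card_le_of_sum_momentMap_mem_range hd (by omega) hk
  have hat := le_antisymm (hle _ hmem) hge
  have hnum : caratheodoryNumber (monomialSystem d) = ((m + 1) / 2 : ℕ) := by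
    refine le_antisymm (sSup_le ?_) (hat ▸ le_sSup ⟨_, hmem, rfl⟩)
    rintro _ ⟨s, hs, rfl⟩
    exact hle s hs
  rw [natCeil_half]
  exact ⟨hnum, _, hmem, hat.trans hnum.symm⟩
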